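/- For integers $q\ge 2$ and $0\le k_1\le k_2$, write $[-k_1,k_2]^*=\{-k_1,\dots,k_2\}\setminus\{0\}$. A set $B\subset\mathbb{Z}_q$ is called a $B[-k_1,k_2](q)$ set if each of the sets $b[-k_1,k_2]^*=\{bs \bmod q : s\in[-k_1,k_2]^*\}$, $b\in B$, has $k_1+k_2$ nonzero elements, and these sets are pairwise disjoint. It is perfect if $|B|=\frac{q-1}{k_1+k_2}$, and a perfect $B[-k_1,k_2](q)$ set is nonsingular if $\gcd(q,k_2!)=1$. Let $p\equiv 1\pmod 6$ be a prime with $\gcd\left(\frac{p-1}{6},6\right)=1$. Then there exists a nonsingular perfect $B[-2,4](p)$ set if and only if there exist $k,l\in\mathbb{Z}$ such that one of the following three conditions holds: 1. $p=1296k^2-648kl+324l^2+36k+72l+7$; 2. $p=1296k^2-648kl+324l^2+1764k-360l+607$; 3. $p=36k^2-108kl+324l^2-102k+558l+241$ and $k+3l\equiv 1$ or $3\pmod 6$. Moreover, with $\omega=\frac{-1+\sqrt{-3}}{2}$, the three cases correspond to the following decompositions $p=\pi\bar\pi$ with $\pi=3m-1+3n\omega$, $m,n\in\mathbb{Z}$.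 Condition 1 holds for some $k,l\in\mathbb{Z}$ if and only if there is such a decomposition with $m,n$ odd, $n\equiv 1\pmod 3$ and $m\equiv 1\pmod{12}$. Condition 2 holds for some $k,l\in\mathbb{Z}$ if and only if there is such a decomposition with $m,n$ odd, $n\equiv 1\pmod 3$ and $m\equiv 9\pmod{12}$. Condition 3 holds for some $k,l\in\mathbb{Z}$ if and only if there is such a decomposition with $m$ even, $n$ odd and $n\equiv 2\pmod 3$. -/

import Mathlib

open scoped Nat

/-- The set `[-k₁, k₂]^* = {-k₁, …, k₂} \ {0}` of integers. -/
noncomputable def puncturedInterval (k₁ k₂ : ℕ) : Finset ℤ :=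
  (Finset.Icc (-(k₁ : ℤ)) (k₂ : ℤ)).erase 0

/-- For `b` in `ℤ/qℤ`, the set `b [-k₁, k₂]^* = {b s mod q : s ∈ [-k₁, k₂]^*}`. -/
noncomputable def dilate (k₁ k₂ : ℕ) {q : ℕ} (b : ZMod q) : Finset (ZMod q) :=
  (puncturedInterval k₁ k₂).image (fun s : ℤ => b * (s : ZMod q))

/-- `B` is a `B[-k₁, k₂](q)` set (a splitter set), where `q ≥ 2` and `0 ≤ k₁ ≤ k₂`:
each `b [-k₁, k₂]^*`, `b ∈ B`, has `k₁ + k₂` elements, all of them nonzero,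
and these sets are pairwise disjoint. -/
structure IsSplitterSet (k₁ k₂ q : ℕ) (B : Finset (ZMod q)) : Prop where
  two_le : 2 ≤ q
  le : k₁ ≤ k₂
  card_dilate : ∀ b ∈ B, (dilate k₁ k₂ b).card = k₁ + k₂
  zero_notMem : ∀ b ∈ B, (0 : ZMod q) ∉ dilate k₁ k₂ b
  disjoint : ∀ b ∈ B, ∀ c ∈ B, b ≠ c → Disjoint (dilate k₁ k₂ b) (dilate k₁ k₂ c)

/-- A splitter set is perfect if `|B| = (q - 1) / (k₁ + k₂)`, as an equality of
rational numbers. -/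
structure IsPerfectSplitterSet (k₁ k₂ q : ℕ) (B : Finset (ZMod q)) : Prop
    extends IsSplitterSet k₁ k₂ q B where
  card_eq : (B.card : ℚ) = ((q : ℚ) - 1) / ((k₁ : ℚ) + (k₂ : ℚ))

/-- A perfect splitter set is nonsingular if `gcd(q, k₂!) = 1`. -/
structure IsNonsingularPerfectSplitterSet (k₁ k₂ q : ℕ) (B : Finset (ZMod q)) : Prop
    extends IsPerfectSplitterSet k₁ k₂ q B where
  gcd_eq_one : Nat.gcd q (k₂ !) = 1

/-- The complex number `ω = (-1 + √-3) / 2`. -/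
noncomputable def eisensteinOmega : ℂ :=
  (-1 + (Real.sqrt 3 : ℂ) * Complex.I) / 2

/-- The Eisenstein integer `3m - 1 + 3nω`, as a complex number. -/
noncomputable def primaryElement (m n : ℤ) : ℂ :=
  3 * (m : ℂ) - 1 + 3 * (n : ℂ) * eisensteinOmega

/-! Write `p = 6N + 1` with `N` prime to 6 and `A = [-2, 4]^*`. A perfect splitter set `B` has `N`
elements and factors the unit group as `A · B`. Because `N` is prime to 2 and 3, the factorization
survives replacing each `b` by `b ^ 6` (`bijective_mul_pow_of_bijective_mul`, twice), and the `N`-th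
power kills `b ^ 6`; hence the `s ^ N`, `s ∈ A`, exhaust the sixth roots of unity. Conversely, if
the `s ^ N` are distinct, the `N`-th roots of unity form such a `B`. With `c = 2 ^ N` and `d = 3 ^
N` these powers are `-c, -1, 1, c, d, c ^ 2`, and the condition becomes: 2 is not a cubic residue
and 6 is.

The cubic characters of 2 and 6 are read off the Jacobi sum `J(χ, χ) = 3m - 1 + 3nω`, without cubic
reciprocity. The number of ways to write `t` as an ordered sum of `q` cubic residues is congruent
mod `q` to 1 or 0 according as `t / q` is a cubic residue or not; it is also an explicit expression
in `p, m, n`. Comparing for `q = 2`, `t = 2` and `q = 3`, `t = 4` gives congruences on `m, n`. The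
decomposition is unique up to conjugation, so these characterize the residue condition. What remains
is arithmetic mod 36. -/

/-! ### Factorizations of finite commutative groups -/

/-- If the products `a i * b k` run through a finite commutative group exactly once, so do the
products `a i * b k ^ q`, for every prime `q` that does not divide the number of `k`. -/
theorem bijective_mul_pow_of_bijective_mul {G ι κ : Type*} [CommGroup G] [Fintype G] [Fintype ι]
    [Fintype κ] (a : ι → G) (b : κ → G)
    (h : Function.Bijective fun x : ι × κ => a x.1 * b x.2)
    (q : ℕ) [hq : Fact q.Prime] (hcard : ¬ q ∣ Fintype.card κ) :
    Function.Bijective fun x : ι × κ => a x.1 * b x.2 ^ q := by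
  classical
  have hc : Fintype.card (ι × κ) = Fintype.card G := Fintype.card_of_bijective h
  refine (Fintype.bijective_iff_surjective_and_card _).2 ⟨fun g => ?_, hc⟩
  by_contra! hg
  let α : MonoidAlgebra (ZMod q) G := ∑ i, MonoidAlgebra.single (a i) 1
  let β : MonoidAlgebra (ZMod q) G := ∑ k, MonoidAlgebra.single (b k) 1
  let σ : MonoidAlgebra (ZMod q) G := ∑ g, MonoidAlgebra.single g 1
  have hαβ : α * β = σ := by
    simp only [α, β, σ, Finset.sum_mul_sum, MonoidAlgebra.single_mul_single, mul_one]
    rw [← Fintype.sum_prod_type' (f := fun i k => MonoidAlgebra.single (a i * b k) (1 : ZMod q))]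
    exact Function.Bijective.sum_comp h (fun g => MonoidAlgebra.single g (1 : ZMod q))
  have hσ (x : G) : σ * MonoidAlgebra.single x 1 = σ := by
    simp only [σ, Finset.sum_mul, MonoidAlgebra.single_mul_single, mul_one]
    exact Equiv.sum_comp (Equiv.mulRight x) (fun g => MonoidAlgebra.single g (1 : ZMod q))
  have hσβ : σ * β = (Fintype.card κ : MonoidAlgebra (ZMod q) G) * σ := by
    simp only [β, Finset.mul_sum, hσ]
    simp
  have hσβ' (j : ℕ) : σ * β ^ j = ((Fintype.card κ ^ j : ℕ) : MonoidAlgebra (ZMod q) G) * σ := by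
    induction j with
    | zero => simp
    | succ j ih => rw [pow_succ, ← mul_assoc, ih, mul_assoc, hσβ]; push_cast; ring
  -- Frobenius turns `β ^ q` into the sum of the `b k ^ q`, while `α * β ^ q = σ * β ^ (q - 1)` has
  -- every coefficient equal to `|κ| ^ (q - 1)`. A missed `g` forces `q ∣ |κ|`.
  have : CharP (MonoidAlgebra (ZMod q) G) q :=
    charP_of_injective_algebraMap (FaithfulSMul.algebraMap_injective (ZMod q) _) q
  have hβ : β ^ q = ∑ k, MonoidAlgebra.single (b k ^ q) 1 := by
    simp only [β, sum_pow_char, MonoidAlgebra.single_pow, one_pow]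
  have key : α * β ^ q = ((Fintype.card κ ^ (q - 1) : ℕ) : MonoidAlgebra (ZMod q) G) * σ := by
    rw [← hσβ', ← hαβ, mul_assoc, ← pow_succ', Nat.sub_add_cancel hq.out.one_le]
  have h1 : (α * β ^ q).coeff g = 0 := by
    rw [hβ]
    simp only [α, Finset.sum_mul_sum, MonoidAlgebra.single_mul_single, mul_one]
    simp only [MonoidAlgebra.coeff_sum, Finsupp.finsetSum_apply, MonoidAlgebra.coeff_single]
    exact Finset.sum_eq_zero fun i _ => Finset.sum_eq_zero fun k _ =>
      Finsupp.single_eq_of_ne (hg (i, k)).symm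
  have h2 : (σ.coeff g) = 1 := by
    simp only [σ, MonoidAlgebra.coeff_sum, Finsupp.finsetSum_apply, MonoidAlgebra.coeff_single]
    simp [Finsupp.single_apply]
  rw [key, ← nsmul_eq_mul, MonoidAlgebra.coeff_smul, Finsupp.smul_apply, h2] at h1
  rw [nsmul_one, ZMod.natCast_eq_zero_iff] at h1
  exact hcard (hq.out.dvd_of_dvd_pow h1)

/-! ### Additive group algebras and convolution -/

/-- The coefficients of the `q`-th power of a sum of distinct basis elements, modulo the
prime `q`. -/
theorem intCast_coeff_sum_single_pow {M : Type*} [AddCommMonoid M] [DecidableEq M] (s : Finset M)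
    (q : ℕ) [hq : Fact q.Prime] (t : M) :
    ((((∑ x ∈ s, AddMonoidAlgebra.single x (1 : ℤ)) ^ q).coeff t : ℤ) : ZMod q) =
      ∑ x ∈ s, if q • x = t then 1 else 0 := by
  have : CharP (AddMonoidAlgebra (ZMod q) M) q :=
    charP_of_injective_algebraMap (FaithfulSMul.algebraMap_injective (ZMod q) _) q
  have h := congrArg (fun z => z.coeff t) <| map_pow
    (AddMonoidAlgebra.mapRingHom M (Int.castRingHom (ZMod q)))
    (∑ x ∈ s, AddMonoidAlgebra.single x (1 : ℤ)) q
  simp only [map_sum, AddMonoidAlgebra.mapRingHom_single, map_one, sum_pow_char,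
    AddMonoidAlgebra.single_pow, one_pow] at h
  simp only [AddMonoidAlgebra.coeff_sum, Finsupp.finsetSum_apply,
    AddMonoidAlgebra.coeff_single, Finsupp.single_apply] at h
  rw [← h]
  rfl

/-- The element of the group algebra with prescribed coefficients. -/
noncomputable def groupAlgebraOfFun {M R : Type*} [Semiring R] [Fintype M] (f : M → R) :
    AddMonoidAlgebra R M :=
  ∑ x, AddMonoidAlgebra.single x (f x)

section

variable {M R : Type*} [CommRing R] [Fintype M]

@[simp]
theorem coeff_groupAlgebraOfFun (f : M → R) (t : M) : (groupAlgebraOfFun f).coeff t = f t := by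
  classical
  simp [groupAlgebraOfFun, AddMonoidAlgebra.coeff_sum, Finsupp.finsetSum_apply,
    AddMonoidAlgebra.coeff_single, Finsupp.single_apply]

theorem coeff_groupAlgebraOfFun_mul [AddCommGroup M] (f g : M → R) (t : M) :
    (groupAlgebraOfFun f * groupAlgebraOfFun g).coeff t = ∑ x, f x * g (t - x) := by
  classical
  simp only [groupAlgebraOfFun, Finset.sum_mul_sum, AddMonoidAlgebra.single_mul_single,
    AddMonoidAlgebra.coeff_sum, Finsupp.finsetSum_apply, AddMonoidAlgebra.coeff_single,
    Finsupp.single_apply]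
  refine Finset.sum_congr rfl fun x _ => ?_
  rw [Finset.sum_eq_single (t - x)]
  · simp
  · intro y _ hy
    rw [if_neg]
    rintro rfl
    exact hy (by abel)
  · simp

theorem groupAlgebraOfFun_one_mul [AddCommGroup M] (g : M → R) :
    groupAlgebraOfFun (fun _ : M => (1 : R)) * groupAlgebraOfFun g =
      (∑ x, g x) • groupAlgebraOfFun (fun _ => 1) := by
  ext t
  rw [coeff_groupAlgebraOfFun_mul]
  simpa using (Equiv.subLeft t).sum_comp g

end

/-! ### Convolution of multiplicative characters -/

section

variable {F R : Type*} [Field F] [Fintype F] [DecidableEq F] [CommRing R] [IsDomain R]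

omit [DecidableEq F] [IsDomain R] in
theorem sum_mulChar_mul_mulChar_sub (χ ψ : MulChar F R) {t : F} (ht : t ≠ 0) :
    ∑ x, χ x * ψ (t - x) = jacobiSum χ ψ * (χ * ψ) t := by
  rw [jacobiSum, ← Equiv.sum_comp (Equiv.mulLeft₀ t ht), Finset.sum_mul]
  refine Finset.sum_congr rfl fun x _ => ?_
  simp only [Equiv.mulLeft₀_apply, MulChar.coeToFun_mul, Pi.mul_apply]
  rw [show t - t * x = t * (1 - x) by ring, map_mul, map_mul]
  ring

omit [DecidableEq F] [IsDomain R] in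
theorem sum_mulChar_mul_mulChar_neg (χ ψ : MulChar F R) :
    ∑ x, χ x * ψ (0 - x) = ψ (-1) * ∑ x, (χ * ψ) x := by
  rw [Finset.mul_sum]
  refine Finset.sum_congr rfl fun x _ => ?_
  simp only [MulChar.coeToFun_mul, Pi.mul_apply]
  rw [show 0 - x = -1 * x by ring, map_mul]
  ring

theorem groupAlgebraOfFun_mulChar_mul {χ ψ : MulChar F R} (h : χ * ψ ≠ 1) :
    groupAlgebraOfFun χ * groupAlgebraOfFun ψ =
      jacobiSum χ ψ • groupAlgebraOfFun (χ * ψ : MulChar F R) := by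
  ext t
  rw [coeff_groupAlgebraOfFun_mul]
  by_cases ht : t = 0
  · subst ht
    rw [sum_mulChar_mul_mulChar_neg, MulChar.sum_eq_zero_of_ne_one h]
    simp [MulChar.map_zero]
  · rw [sum_mulChar_mul_mulChar_sub _ _ ht]
    simp

theorem groupAlgebraOfFun_mulChar_mul_inv {χ : MulChar F R} (h : χ ≠ 1) (h' : χ (-1) = 1) :
    groupAlgebraOfFun χ * groupAlgebraOfFun (χ⁻¹ : MulChar F R) =
      (Fintype.card F : R) • 1 - groupAlgebraOfFun (fun _ => 1) := by
  ext t
  rw [coeff_groupAlgebraOfFun_mul]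
  by_cases ht : t = 0
  · subst ht
    rw [sum_mulChar_mul_mulChar_neg, mul_inv_cancel, MulChar.sum_one_eq_card_units,
      MulChar.inv_apply', inv_neg, inv_one, h', Fintype.card_units,
      Nat.cast_sub Fintype.card_pos]
    simp [AddMonoidAlgebra.one_def]
  · rw [sum_mulChar_mul_mulChar_sub _ _ ht, mul_inv_cancel, jacobiSum_nontrivial_inv h, h',
      MulChar.one_apply (Ne.isUnit ht)]
    simp [AddMonoidAlgebra.one_def, Ne.symm ht]

end

/-! ### Counting sums of two or three cubic residues -/

section

variable {F : Type*} [Field F] [Fintype F] [DecidableEq F] {χ : MulChar F ℂ}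

/-- The kernel of a multiplicative character, as a finite set. -/
noncomputable def mulCharKer (χ : MulChar F ℂ) : Finset F :=
  Finset.univ.filter fun x => χ x = 1

omit [Fintype F] [DecidableEq F] in
theorem MulChar.map_neg_one_of_pow_three (h3 : χ ^ 3 = 1) : χ (-1) = 1 := by
  have h : (χ ^ 3) (-1) = 1 := by rw [h3, MulChar.one_apply isUnit_one.neg]
  rw [MulChar.pow_apply' _ (by norm_num), ← map_pow] at h
  rwa [show (-1 : F) ^ 3 = -1 by ring] at h

omit [Fintype F] [DecidableEq F] in
theorem MulChar.mul_self_of_pow_three (h3 : χ ^ 3 = 1) : χ * χ = χ⁻¹ := by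
  rw [eq_inv_iff_mul_eq_one, ← h3, pow_succ, sq]

omit [Fintype F] [DecidableEq F] in
theorem MulChar.inv_mul_inv_of_pow_three (h3 : χ ^ 3 = 1) : χ⁻¹ * χ⁻¹ = χ := by
  rw [← mul_self_of_pow_three h3, show χ * χ * (χ * χ) = χ ^ 3 * χ by simp only [pow_succ, pow_zero, one_mul, mul_assoc], h3, one_mul]

omit [Fintype F] [DecidableEq F] in
theorem MulChar.apply_pow_three (h3 : χ ^ 3 = 1) {x : F} (hx : x ≠ 0) : χ x ^ 3 = 1 := by
  rw [← MulChar.pow_apply' _ (by norm_num), h3, MulChar.one_apply hx.isUnit]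

omit [Fintype F] [DecidableEq F] in
theorem MulChar.inv_apply_of_pow_three (h3 : χ ^ 3 = 1) (x : F) : χ⁻¹ x = χ x ^ 2 := by
  rw [← mul_self_of_pow_three h3, sq]; rfl

/-- For a cube root of unity `z`, `1 + z + z ^ 2` is 3 or 0 according as `z = 1` or not. The `- 1`
removes the contribution of the all-ones function at the origin. -/
theorem three_smul_sum_single_mulCharKer (h3 : χ ^ 3 = 1) :
    (3 : ℂ) • ∑ x ∈ mulCharKer χ, AddMonoidAlgebra.single x (1 : ℂ) =
      groupAlgebraOfFun (fun _ => 1) - 1 + groupAlgebraOfFun χ +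
        groupAlgebraOfFun (χ⁻¹ : MulChar F ℂ) := by
  ext t
  have : (∑ x ∈ mulCharKer χ, AddMonoidAlgebra.single x (1 : ℂ)).coeff t =
      if χ t = 1 then 1 else 0 := by
    simp [AddMonoidAlgebra.coeff_sum, Finsupp.finsetSum_apply, AddMonoidAlgebra.coeff_single,
      Finsupp.single_apply, mulCharKer]
  simp only [AddMonoidAlgebra.coeff_smul, Finsupp.smul_apply, this, AddMonoidAlgebra.coeff_add,
    AddMonoidAlgebra.coeff_sub, Finsupp.add_apply, Finsupp.sub_apply, coeff_groupAlgebraOfFun,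
    AddMonoidAlgebra.one_def, AddMonoidAlgebra.coeff_single, Finsupp.single_apply,
    MulChar.inv_apply_of_pow_three h3]
  by_cases ht : t = 0
  · subst ht
    simp [MulChar.map_zero]
  · rw [if_neg (Ne.symm ht)]
    by_cases h : χ t = 1
    · rw [if_pos h, h]; norm_num
    · rw [if_neg h]
      have h1 := MulChar.apply_pow_three h3 ht
      have h2 : (χ t - 1) * (χ t ^ 2 + χ t + 1) = 0 := by linear_combination h1
      have h4 := (mul_eq_zero.1 h2).resolve_left (sub_ne_zero.2 h)
      simp only [smul_zero]
      linear_combination -h4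

variable (hχ : χ ≠ 1) (h3 : χ ^ 3 = 1)
include hχ h3

theorem groupAlgebra_cubic_sq :
    (groupAlgebraOfFun (fun _ => 1) - 1 + groupAlgebraOfFun χ +
        groupAlgebraOfFun (χ⁻¹ : MulChar F ℂ)) ^ 2 =
      ((Fintype.card F : ℂ) - 4) • groupAlgebraOfFun (fun _ => 1) +
        (1 + 2 * (Fintype.card F : ℂ)) • 1 +
        (jacobiSum χ⁻¹ χ⁻¹ - 2) • groupAlgebraOfFun χ +
        (jacobiSum χ χ - 2) • groupAlgebraOfFun (χ⁻¹ : MulChar F ℂ) := by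
  have hχ' : χ⁻¹ ≠ 1 := inv_ne_one.2 hχ
  have hUU := groupAlgebraOfFun_one_mul (fun _ : F => (1 : ℂ))
  have hUX := groupAlgebraOfFun_one_mul χ
  have hUY := groupAlgebraOfFun_one_mul (χ⁻¹ : MulChar F ℂ)
  have hXX := groupAlgebraOfFun_mulChar_mul
    (by rwa [MulChar.mul_self_of_pow_three h3] : χ * χ ≠ 1)
  have hYY := groupAlgebraOfFun_mulChar_mul
    (by rwa [MulChar.inv_mul_inv_of_pow_three h3] : χ⁻¹ * χ⁻¹ ≠ 1)
  have hXY := groupAlgebraOfFun_mulChar_mul_inv hχ (MulChar.map_neg_one_of_pow_three h3)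
  rw [MulChar.sum_eq_zero_of_ne_one hχ, zero_smul] at hUX
  rw [MulChar.sum_eq_zero_of_ne_one hχ', zero_smul] at hUY
  rw [MulChar.mul_self_of_pow_three h3] at hXX
  rw [MulChar.inv_mul_inv_of_pow_three h3] at hYY
  simp only [Finset.sum_const, Finset.card_univ, nsmul_eq_mul, mul_one] at hUU
  simp only [Algebra.smul_def, map_sub, map_add, map_mul, map_one, map_ofNat] at *
  linear_combination hUU + 2 * hUX + 2 * hUY + hXX + hYY + 2 * hXY

/-- Multiply the square by one more factor, with `U * χ = 0`, `χ * χ = J(χ, χ) χ⁻¹`, `χ * χ⁻¹ = |F|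
- U` as convolutions (`U` the all-ones function) and `J(χ, χ) J(χ⁻¹, χ⁻¹) = |F|`. -/
theorem groupAlgebra_cubic_cube :
    (groupAlgebraOfFun (fun _ => 1) - 1 + groupAlgebraOfFun χ +
        groupAlgebraOfFun (χ⁻¹ : MulChar F ℂ)) ^ 3 =
      ((Fintype.card F : ℂ) ^ 2 - 3 * (Fintype.card F : ℂ) + 9 -
        (jacobiSum χ χ + jacobiSum χ⁻¹ χ⁻¹)) • groupAlgebraOfFun (fun _ => 1) +
        ((Fintype.card F : ℂ) * (jacobiSum χ χ + jacobiSum χ⁻¹ χ⁻¹) -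
          6 * (Fintype.card F : ℂ) - 1) • 1 +
        (3 + 3 * (Fintype.card F : ℂ) - 3 * jacobiSum χ⁻¹ χ⁻¹) • groupAlgebraOfFun χ +
        (3 + 3 * (Fintype.card F : ℂ) - 3 * jacobiSum χ χ) •
          groupAlgebraOfFun (χ⁻¹ : MulChar F ℂ) := by
  have hχ' : χ⁻¹ ≠ 1 := inv_ne_one.2 hχ
  have hUU := groupAlgebraOfFun_one_mul (fun _ : F => (1 : ℂ))
  have hUX := groupAlgebraOfFun_one_mul χ
  have hUY := groupAlgebraOfFun_one_mul (χ⁻¹ : MulChar F ℂ)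
  have hXX := groupAlgebraOfFun_mulChar_mul
    (by rwa [MulChar.mul_self_of_pow_three h3] : χ * χ ≠ 1)
  have hYY := groupAlgebraOfFun_mulChar_mul
    (by rwa [MulChar.inv_mul_inv_of_pow_three h3] : χ⁻¹ * χ⁻¹ ≠ 1)
  have hXY := groupAlgebraOfFun_mulChar_mul_inv hχ (MulChar.map_neg_one_of_pow_three h3)
  have hJ := congrArg (algebraMap ℂ (AddMonoidAlgebra ℂ F)) <|
    jacobiSum_mul_jacobiSum_inv (F' := ℂ) (by
      rw [ringChar.eq_zero]; exact (CharP.ringChar_ne_zero_of_finite F).symm) hχ hχ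
      (by rwa [MulChar.mul_self_of_pow_three h3] : χ * χ ≠ 1)
  rw [MulChar.sum_eq_zero_of_ne_one hχ, zero_smul] at hUX
  rw [MulChar.sum_eq_zero_of_ne_one hχ', zero_smul] at hUY
  rw [MulChar.mul_self_of_pow_three h3] at hXX
  rw [MulChar.inv_mul_inv_of_pow_three h3] at hYY
  simp only [Finset.sum_const, Finset.card_univ, nsmul_eq_mul, mul_one] at hUU
  rw [pow_succ, groupAlgebra_cubic_sq hχ h3]
  simp only [Algebra.smul_def, map_sub, map_add, map_mul, map_one, map_ofNat, map_pow] at *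
  set P := algebraMap ℂ (AddMonoidAlgebra ℂ F) (Fintype.card F : ℂ)
  set j := algebraMap ℂ (AddMonoidAlgebra ℂ F) (jacobiSum χ χ)
  set j' := algebraMap ℂ (AddMonoidAlgebra ℂ F) (jacobiSum χ⁻¹ χ⁻¹)
  set X := groupAlgebraOfFun χ
  set Y := groupAlgebraOfFun (χ⁻¹ : MulChar F ℂ)
  linear_combination (P - 4) * (hUU + hUX + hUY) + (j' - 2) * (hUX + hXX + hXY) +
    (j - 2) * (hUY + hXY + hYY) + (X + Y) * hJ

theorem nine_mul_coeff_sum_mulCharKer_sq {t : F} (ht : t ≠ 0) :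
    9 * (((∑ x ∈ mulCharKer χ, AddMonoidAlgebra.single x (1 : ℤ)) ^ 2).coeff t : ℂ) =
      (Fintype.card F : ℂ) - 4 + (jacobiSum χ⁻¹ χ⁻¹ - 2) * χ t +
        (jacobiSum χ χ - 2) * χ t ^ 2 := by
  have h := congrArg (fun z => z.coeff t) <| map_pow
    (AddMonoidAlgebra.mapRingHom F (Int.castRingHom ℂ))
    (∑ x ∈ mulCharKer χ, AddMonoidAlgebra.single x (1 : ℤ)) 2
  simp only [map_sum, AddMonoidAlgebra.mapRingHom_single, map_one] at h
  have h' := congrArg (fun z => (z ^ 2).coeff t) (three_smul_sum_single_mulCharKer h3)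
  simp only [groupAlgebra_cubic_sq hχ h3] at h'
  simp only [smul_pow, AddMonoidAlgebra.coeff_smul,
    Finsupp.smul_apply, ← h, AddMonoidAlgebra.coeff_add, Finsupp.add_apply,
    coeff_groupAlgebraOfFun, AddMonoidAlgebra.one_def, AddMonoidAlgebra.coeff_single,
    Finsupp.single_apply, if_neg (Ne.symm ht), MulChar.inv_apply_of_pow_three h3, smul_eq_mul,
    mul_one, mul_zero, add_zero] at h'
  rw [← h', show (3 : ℂ) ^ 2 = 9 by norm_num]
  rfl

theorem twenty_seven_mul_coeff_sum_mulCharKer_cube {t : F} (ht : t ≠ 0) :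
    27 * (((∑ x ∈ mulCharKer χ, AddMonoidAlgebra.single x (1 : ℤ)) ^ 3).coeff t : ℂ) =
      (Fintype.card F : ℂ) ^ 2 - 3 * (Fintype.card F : ℂ) + 9 -
        (jacobiSum χ χ + jacobiSum χ⁻¹ χ⁻¹) +
        (3 + 3 * (Fintype.card F : ℂ) - 3 * jacobiSum χ⁻¹ χ⁻¹) * χ t +
        (3 + 3 * (Fintype.card F : ℂ) - 3 * jacobiSum χ χ) * χ t ^ 2 := by
  have h := congrArg (fun z => z.coeff t) <| map_pow
    (AddMonoidAlgebra.mapRingHom F (Int.castRingHom ℂ))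
    (∑ x ∈ mulCharKer χ, AddMonoidAlgebra.single x (1 : ℤ)) 3
  simp only [map_sum, AddMonoidAlgebra.mapRingHom_single, map_one] at h
  have h' := congrArg (fun z => (z ^ 3).coeff t) (three_smul_sum_single_mulCharKer h3)
  simp only [groupAlgebra_cubic_cube hχ h3] at h'
  simp only [smul_pow, AddMonoidAlgebra.coeff_smul,
    Finsupp.smul_apply, ← h, AddMonoidAlgebra.coeff_add, Finsupp.add_apply,
    coeff_groupAlgebraOfFun, AddMonoidAlgebra.one_def, AddMonoidAlgebra.coeff_single,
    Finsupp.single_apply, if_neg (Ne.symm ht), MulChar.inv_apply_of_pow_three h3, smul_eq_mul,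
    mul_one, mul_zero, add_zero] at h'
  rw [← h', show (3 : ℂ) ^ 3 = 27 by norm_num]
  rfl

end

/-! ### Cubic Jacobi sums and the cubic characters of 2 and 6 -/

theorem IsPrimitiveRoot.mem_adjoin_three {R : Type*} [CommRing R] [IsDomain R] {μ z : R}
    (hμ : IsPrimitiveRoot μ 3) (hz : z ∈ Algebra.adjoin ℤ {μ}) :
    ∃ c d : ℤ, z = c + d * μ := by
  have h : μ ^ 2 + μ + 1 = 0 := by
    have := hμ.geom_sum_eq_zero (by norm_num)
    simp only [Finset.sum_range_succ, Finset.sum_range_zero] at this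
    linear_combination this
  induction hz using Algebra.adjoin_induction with
  | mem x hx => exact ⟨0, 1, by rw [Set.mem_singleton_iff.1 hx]; simp⟩
  | algebraMap r => exact ⟨r, 0, by simp⟩
  | add x y _ _ hx hy =>
    obtain ⟨a, b, rfl⟩ := hx
    obtain ⟨c, d, rfl⟩ := hy
    exact ⟨a + c, b + d, by push_cast; ring⟩
  | mul x y _ _ hx hy =>
    obtain ⟨a, b, rfl⟩ := hx
    obtain ⟨c, d, rfl⟩ := hy
    exact ⟨a * c - b * d, a * d + b * c - b * d, by
      push_cast; linear_combination (b : R) * d * h⟩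

section

variable {p : ℕ} [hp : Fact p.Prime] {χ : MulChar (ZMod p) ℂ} {μ : ℂ}

theorem exists_jacobiSum_cubic_eq (hp3 : 3 ∣ p - 1) (hχ : χ ≠ 1) (h3 : χ ^ 3 = 1)
    (hμ : IsPrimitiveRoot μ 3) :
    ∃ m n : ℤ, jacobiSum χ χ = 3 * m - 1 + 3 * n * μ ∧
      jacobiSum χ⁻¹ χ⁻¹ = 3 * m - 1 + 3 * n * μ ^ 2 ∧
      (p : ℤ) = (3 * m - 1) ^ 2 - (3 * m - 1) * (3 * n) + (3 * n) ^ 2 := by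
  have h : μ ^ 2 + μ + 1 = 0 := by
    have := hμ.geom_sum_eq_zero (by norm_num)
    simp only [Finset.sum_range_succ, Finset.sum_range_zero] at this
    linear_combination this
  obtain ⟨z, hz, hJ⟩ := exists_jacobiSum_eq_neg_one_add (by norm_num) h3 h3
    (by rwa [ZMod.card]) hμ
  obtain ⟨c, d, rfl⟩ := hμ.mem_adjoin_three hz
  -- Here `J = -1 + z (μ - 1) ^ 2` with `z = c + d μ`, and `(μ - 1) ^ 2 = -3μ`; so `m = d` and `n =
  -- d - c`.
  have hJ1 : jacobiSum χ χ = 3 * (d : ℤ) - 1 + 3 * ((d - c : ℤ) : ℂ) * μ := by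
    rw [hJ]; push_cast; linear_combination ((c : ℂ) - 3 * d + d * μ) * h
  have hconj : starRingEnd ℂ μ = μ ^ 2 := by
    rw [← Complex.inv_eq_conj (hμ.norm'_eq_one (by norm_num))]
    exact inv_eq_of_mul_eq_one_right (by rw [← pow_succ', hμ.pow_eq_one])
  have hJ2 : jacobiSum χ⁻¹ χ⁻¹ = 3 * (d : ℤ) - 1 + 3 * ((d - c : ℤ) : ℂ) * μ ^ 2 := by
    have : jacobiSum χ⁻¹ χ⁻¹ = starRingEnd ℂ (jacobiSum χ χ) := by
      simp only [jacobiSum, map_sum, map_mul]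
      refine Finset.sum_congr rfl fun x _ => ?_
      rw [← MulChar.star_apply', ← MulChar.star_apply']
      rfl
    rw [this, hJ1]
    simp only [map_add, map_sub, map_mul, map_one, map_ofNat, map_intCast, hconj]
  refine ⟨d, d - c, hJ1, hJ2, ?_⟩
  have hp' := jacobiSum_mul_jacobiSum_inv (F' := ℂ) (by
      rw [ringChar.eq_zero]; exact (CharP.ringChar_ne_zero_of_finite (ZMod p)).symm) hχ hχ
      (by rw [MulChar.mul_self_of_pow_three h3]; exact inv_ne_one.2 hχ : χ * χ ≠ 1)
  rw [hJ1, hJ2, ZMod.card] at hp'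
  have hC : (p : ℂ) = (3 * d - 1) ^ 2 - (3 * d - 1) * (3 * ((d - c : ℤ) : ℂ)) +
      (3 * ((d - c : ℤ) : ℂ)) ^ 2 := by
    rw [← hp']
    linear_combination
      (9 * (((d - c : ℤ) : ℂ)) ^ 2 * (μ - 1) + 3 * (3 * d - 1) * ((d - c : ℤ) : ℂ)) * h
  exact_mod_cast hC

theorem sum_ite_smul_eq {q : ℕ} (hq : (q : ZMod p) ≠ 0) (s : Finset (ZMod p)) (t : ZMod p)
    {R : Type*} [Semiring R] :
    ∑ x ∈ s, (if q • x = t then (1 : R) else 0) = if t / q ∈ s then 1 else 0 := by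
  have (x : ZMod p) : q • x = t ↔ x = t / q := by
    rw [nsmul_eq_mul, eq_div_iff hq, mul_comm]
  simp only [this, Finset.sum_ite_eq']

/-- The number `T` of ordered pairs of cubic residues with sum 2 is odd, since swapping fixes only
the pair `(1, 1)`. Its Jacobi sum formula then determines the parity of `n`. -/
theorem exists_decomposition_of_cubic_apply_two_eq_one (hp2 : (2 : ZMod p) ≠ 0)
    (hp3 : 3 ∣ p - 1) (hχ : χ ≠ 1) (h3 : χ ^ 3 = 1) (h2 : χ 2 = 1) :
    ∃ m n : ℤ, (p : ℤ) = (3 * m - 1) ^ 2 - (3 * m - 1) * (3 * n) + (3 * n) ^ 2 ∧ Even n := by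
  have hμ := Complex.isPrimitiveRoot_exp 3 (by norm_num)
  set μ := Complex.exp (2 * Real.pi * Complex.I / (3 : ℕ))
  have h : μ ^ 2 + μ + 1 = 0 := by
    have := hμ.geom_sum_eq_zero (by norm_num)
    simp only [Finset.sum_range_succ, Finset.sum_range_zero] at this
    linear_combination this
  obtain ⟨m, n, hJ, hJ', hmn⟩ := exists_jacobiSum_cubic_eq hp3 hχ h3 hμ
  refine ⟨m, n, hmn, ?_⟩
  have hT := nine_mul_coeff_sum_mulCharKer_sq hχ h3 hp2
  have hT' := intCast_coeff_sum_single_pow (mulCharKer χ) 2 (2 : ZMod p)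
  rw [sum_ite_smul_eq (by exact_mod_cast hp2), Nat.cast_ofNat, div_self hp2,
    if_pos (by simp [mulCharKer])] at hT'
  set T := ((∑ x ∈ mulCharKer χ, AddMonoidAlgebra.single x (1 : ℤ)) ^ 2).coeff 2
  rw [hJ, hJ', h2, ZMod.card] at hT
  have hT2 : (9 : ℂ) * T = p - 10 + 6 * m - 3 * n := by linear_combination hT + 3 * n * h
  have hT3 : 9 * T = p - 10 + 6 * m - 3 * n := by exact_mod_cast hT2
  have hodd : Odd T := by
    rw [← ZMod.intCast_eq_one_iff_odd]; exact hT'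
  have hp_odd : Odd p := hp.out.odd_of_ne_two (by rintro rfl; exact hp2 rfl)
  obtain ⟨a, ha⟩ := hodd
  obtain ⟨b, hb⟩ := hp_odd
  rw [Int.even_iff]
  omega

/-- Taking `χ 2` itself as the cube root of unity makes the counts at 2 and 4 integer polynomials in
`p, m, n`. The pair count at 2 gives the parity of `m`; the triple count at 4 decides whether `4 /
3`, equivalently 6, lies in the kernel. -/
theorem exists_decomposition_of_cubic_apply_two_ne_one (hp2 : (2 : ZMod p) ≠ 0)
    (hp3' : (3 : ZMod p) ≠ 0) (hp3 : 3 ∣ p - 1) (hχ : χ ≠ 1) (h3 : χ ^ 3 = 1) (h2 : χ 2 ≠ 1) :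
    ∃ m n : ℤ, (p : ℤ) = (3 * m - 1) ^ 2 - (3 * m - 1) * (3 * n) + (3 * n) ^ 2 ∧
      Odd m ∧ Odd n ∧ (χ 6 = 1 ↔ n ≡ 1 [ZMOD 3]) := by
  have hcube := MulChar.apply_pow_three h3 hp2
  have hμ : IsPrimitiveRoot (χ 2) 3 := by
    rw [← orderOf_eq_prime hcube h2]
    exact IsPrimitiveRoot.orderOf _
  have h : χ 2 ^ 2 + χ 2 + 1 = 0 := by
    have := hμ.geom_sum_eq_zero (by norm_num)
    simp only [Finset.sum_range_succ, Finset.sum_range_zero] at this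
    linear_combination this
  obtain ⟨m, n, hJ, hJ', hmn⟩ := exists_jacobiSum_cubic_eq hp3 hχ h3 hμ
  have hp4 : (4 : ZMod p) ≠ 0 := by
    rw [show (4 : ZMod p) = 2 * 2 by norm_num]; exact mul_ne_zero hp2 hp2
  have hχ4 : χ 4 = χ 2 ^ 2 := by
    rw [show (4 : ZMod p) = 2 * 2 by norm_num, map_mul, sq]
  have hχ6 : χ 6 = χ 2 * χ 3 := by
    rw [show (6 : ZMod p) = 2 * 3 by norm_num, map_mul]
  have hp_odd : Odd p := hp.out.odd_of_ne_two (by rintro rfl; exact hp2 rfl)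
  have hm : Odd m := by
    have hT := nine_mul_coeff_sum_mulCharKer_sq hχ h3 hp2
    have hT' := intCast_coeff_sum_single_pow (mulCharKer χ) 2 (2 : ZMod p)
    rw [sum_ite_smul_eq (by exact_mod_cast hp2), Nat.cast_ofNat, div_self hp2,
      if_pos (by simp [mulCharKer])] at hT'
    set T := ((∑ x ∈ mulCharKer χ, AddMonoidAlgebra.single x (1 : ℤ)) ^ 2).coeff 2
    rw [hJ, hJ', ZMod.card] at hT
    have hT2 : (9 : ℂ) * T = p - 4 - (3 * m - 3) + 6 * n := by
      linear_combination hT + (3 * m - 3) * h + 6 * n * hcube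
    have hT3 : 9 * T = p - 4 - (3 * m - 3) + 6 * n := by exact_mod_cast hT2
    have hodd : Odd T := by
      rw [← ZMod.intCast_eq_one_iff_odd]; exact hT'
    obtain ⟨a, ha⟩ := hodd
    obtain ⟨b, hb⟩ := hp_odd
    rw [Int.odd_iff]
    omega
  refine ⟨m, n, hmn, hm, ?_, ?_⟩
  · have : Odd (p : ℤ) := by exact_mod_cast hp_odd
    rw [hmn] at this
    by_contra hn
    rw [Int.not_odd_iff_even] at hn
    obtain ⟨a, rfl⟩ := hm
    obtain ⟨b, rfl⟩ := hn
    rw [← Int.not_even_iff_odd] at this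
    exact this ⟨18 * a ^ 2 + 12 * a + 2 - 18 * a * b - 6 * b + 18 * b ^ 2, by ring⟩
  · have hS := twenty_seven_mul_coeff_sum_mulCharKer_cube hχ h3 hp4
    have hS' := intCast_coeff_sum_single_pow (mulCharKer χ) 3 (4 : ZMod p)
    rw [sum_ite_smul_eq (by exact_mod_cast hp3'), Nat.cast_ofNat] at hS'
    set S := ((∑ x ∈ mulCharKer χ, AddMonoidAlgebra.single x (1 : ℤ)) ^ 3).coeff 4
    rw [hJ, hJ', ZMod.card, hχ4] at hS
    have hS2 : (27 : ℂ) * S = p ^ 2 - 6 * p + 5 + 3 * m + 12 * n := by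
      linear_combination hS + (3 + 3 * (p : ℂ) - 9 * m + 3 - 12 * n) * h +
        ((3 + 3 * (p : ℂ) - 9 * m + 3) * χ 2 - 9 * n * (χ 2 ^ 2 + χ 2)) * hcube
    have hS3 : 27 * S = p ^ 2 - 6 * p + 5 + 3 * m + 12 * n := by exact_mod_cast hS2
    have hS4 : S = 3 * (m ^ 2 - m * n + n ^ 2) ^ 2 +
        2 * (n - 2 * m) * (m ^ 2 - m * n + n ^ 2) + m - n ^ 2 := by
      rw [hmn] at hS3
      linarith
    have hmem : (4 / 3 : ZMod p) ∈ mulCharKer χ ↔ χ 6 = 1 := by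
      have h43 : χ (4 / 3) * χ 3 = χ 2 ^ 2 := by
        rw [← map_mul, div_mul_cancel₀ _ hp3', hχ4]
      have h30 := MulChar.apply_pow_three h3 hp3'
      have hne : χ 2 ≠ 0 := fun h0 => by simp [h0] at hcube
      simp only [mulCharKer, Finset.mem_filter, Finset.mem_univ, true_and, hχ6]
      constructor
      · intro h1
        rw [h1, one_mul] at h43
        rw [h43, ← hcube]; ring
      · intro h1
        apply mul_left_cancel₀ (pow_ne_zero 2 hne)
        linear_combination χ 2 ^ 3 * h43 - χ 2 ^ 2 * χ (4 / 3) * h1 + (χ 2 ^ 2) * hcube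
    rw [← hmem]
    have h3S : ((S : ℤ) : ZMod 3) = (n : ZMod 3) * (2 - n) := by
      rw [hS4]
      push_cast
      generalize (m : ZMod 3) = a
      generalize (n : ZMod 3) = b
      revert a b
      decide
    have hn3 : n ≡ 1 [ZMOD 3] ↔ (n : ZMod 3) = 1 := by
      simpa using (ZMod.intCast_eq_intCast_iff n 1 3).symm
    have hb : ∀ b : ZMod 3, b = 1 ↔ b * (2 - b) ≠ 0 := by decide
    rw [hn3, hb, ← h3S, hS']
    split_ifs with h1 <;> simp [h1]

end

/-! ### Uniqueness of the norm decomposition -/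

/-- Two decompositions of a prime as the norm of `3m - 1 + 3nω` agree up to conjugation. -/
theorem norm_decomposition_unique {p : ℕ} (hp : p.Prime) {m n m' n' : ℤ}
    (h : (p : ℤ) = (3 * m - 1) ^ 2 - (3 * m - 1) * (3 * n) + (3 * n) ^ 2)
    (h' : (p : ℤ) = (3 * m' - 1) ^ 2 - (3 * m' - 1) * (3 * n') + (3 * n') ^ 2) :
    (m' = m ∧ n' = n) ∨ (m' = m - n ∧ n' = -n) := by
  obtain ⟨L, hL⟩ : ∃ L, L = 2 * (3 * m - 1) - 3 * n := ⟨_, rfl⟩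
  obtain ⟨L', hL'⟩ : ∃ L', L' = 2 * (3 * m' - 1) - 3 * n' := ⟨_, rfl⟩
  have e : 4 * (p : ℤ) = L ^ 2 + 27 * n ^ 2 := by rw [h, hL]; ring
  have e' : 4 * (p : ℤ) = L' ^ 2 + 27 * n' ^ 2 := by rw [h', hL']; ring
  have hpos : 0 < (p : ℤ) := by exact_mod_cast hp.pos
  have hdvd : (p : ℤ) ∣ (L * n' - L' * n) * (L * n' + L' * n) :=
    ⟨4 * (n' ^ 2 - n ^ 2), by linear_combination n ^ 2 * e' - n' ^ 2 * e⟩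
  have key (ε : ℤ) (hε : ε ^ 2 = 1) (hd : (p : ℤ) ∣ L * n' - ε * L' * n) :
      L * n' = ε * L' * n := by
    -- Brahmagupta's identity for `L ^ 2 + 27 n ^ 2`. It bounds the square of the difference by `16
    -- p ^ 2 / 27`, so a difference divisible by `p` vanishes.
    have hid : (4 * (p : ℤ)) ^ 2 = (L * L' + 27 * ε * (n * n')) ^ 2 +
        27 * (L * n' - ε * L' * n) ^ 2 := by
      rw [sq]; nth_rw 1 [e]; rw [e']
      linear_combination (-27 * L' ^ 2 * n ^ 2 - 729 * n ^ 2 * n' ^ 2) * hε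
    have hlt : (L * n' - ε * L' * n) ^ 2 < (p : ℤ) ^ 2 := by
      nlinarith [sq_nonneg (L * L' + 27 * ε * (n * n')), pow_pos hpos 2]
    have := Int.eq_zero_of_abs_lt_dvd hd (by
      rw [← abs_of_pos hpos]; exact sq_lt_sq.1 hlt)
    linarith
  have hprime : Prime (p : ℤ) := Nat.prime_iff_prime_int.1 hp
  have hLn : ∃ ε : ℤ, (ε = 1 ∨ ε = -1) ∧ L * n' = ε * L' * n := by
    rcases hprime.dvd_or_dvd hdvd with hd | hd
    · exact ⟨1, Or.inl rfl, key 1 (by norm_num) (by simpa using hd)⟩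
    · exact ⟨-1, Or.inr rfl, key (-1) (by norm_num) (by simpa using hd)⟩
  obtain ⟨ε, hε, hLn⟩ := hLn
  have hε2 : ε ^ 2 = 1 := by rcases hε with rfl | rfl <;> norm_num
  have hn2 : n' ^ 2 = n ^ 2 := by
    have : 4 * (p : ℤ) * (n' ^ 2 - n ^ 2) = 0 := by
      linear_combination n' ^ 2 * e - n ^ 2 * e' + (L * n' + ε * L' * n) * hLn +
        L' ^ 2 * n ^ 2 * hε2
    have := (mul_eq_zero.1 this).resolve_left (by positivity)
    linarith
  have hL2 : L' ^ 2 = L ^ 2 := by linarith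
  -- Both `L` and `L'` are 1 mod 3, which excludes `L' = -L`.
  have hLL : L' = L := by
    rcases sq_eq_sq_iff_eq_or_eq_neg.1 hL2 with h1 | h1 <;> omega
  rcases sq_eq_sq_iff_eq_or_eq_neg.1 hn2 with h1 | h1
  · left; constructor <;> omega
  · right; constructor <;> omega

/-! ### Splitter sets and cubic residues -/

theorem puncturedInterval_two_four : puncturedInterval 2 4 = {-2, -1, 1, 2, 3, 4} := by
  unfold puncturedInterval
  decide

section

variable {p : ℕ} [hp : Fact p.Prime]

theorem ZMod.exists_isPrimitiveRoot_units (p : ℕ) [hp : Fact p.Prime] :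
    ∃ g : (ZMod p)ˣ, IsPrimitiveRoot g (p - 1) ∧ ∀ x, ∃ k : ℕ, g ^ k = x := by
  obtain ⟨g, hg⟩ := IsCyclic.exists_monoid_generator (α := (ZMod p)ˣ)
  refine ⟨g, ?_, fun x => Submonoid.mem_powers_iff _ _ |>.1 (hg x)⟩
  have : orderOf g = p - 1 := by
    rw [orderOf_eq_card_of_forall_mem_powers hg, Nat.card_eq_fintype_card, ZMod.card_units]
  rw [← this]
  exact IsPrimitiveRoot.orderOf g

/-- A nontrivial cubic character takes the value `1` exactly at the cubic residues. -/
theorem MulChar.cubic_apply_eq_one_iff {N : ℕ} (hN : p = 6 * N + 1) {χ : MulChar (ZMod p) ℂ}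
    (hχ : χ ≠ 1) (h3 : χ ^ 3 = 1) {x : ZMod p} (hx : x ≠ 0) : χ x = 1 ↔ x ^ (2 * N) = 1 := by
  obtain ⟨g, hg, hgen⟩ := ZMod.exists_isPrimitiveRoot_units p
  have hN0 : 0 < N := by
    rcases Nat.eq_zero_or_pos N with rfl | h
    · exact absurd hN (by simpa using hp.out.one_lt.ne')
    · exact h
  have hg1 : χ (g : ZMod p) ≠ 1 := by
    intro h
    refine hχ (MulChar.ext fun y => ?_)
    obtain ⟨k, rfl⟩ := hgen y
    rw [Units.val_pow_eq_pow_val, map_pow, h, one_pow, ← Units.val_pow_eq_pow_val,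
      MulChar.one_apply (Units.isUnit _)]
  have hord : orderOf (χ (g : ZMod p)) = 3 :=
    orderOf_eq_prime (MulChar.apply_pow_three h3 g.ne_zero) hg1
  obtain ⟨k, hk⟩ := hgen (Units.mk0 x hx)
  have hx' : x = (g : ZMod p) ^ k := by rw [← Units.val_pow_eq_pow_val, hk, Units.val_mk0]
  rw [hx', map_pow, ← orderOf_dvd_iff_pow_eq_one, hord, ← pow_mul,
    (IsPrimitiveRoot.coe_units_iff.2 hg).pow_eq_one_iff_dvd]
  rw [show p - 1 = (2 * N) * 3 by omega, mul_comm k]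
  exact (Nat.mul_dvd_mul_iff_left (by positivity)).symm

theorem natCast_ne_zero_of_lt {a : ℕ} (ha : a ≠ 0) (h : a < p) : (a : ZMod p) ≠ 0 := by
  rw [Ne, ZMod.natCast_eq_zero_iff]
  exact Nat.not_dvd_of_pos_of_lt (Nat.pos_of_ne_zero ha) h

theorem intCast_ne_zero_of_mem_puncturedInterval (h2 : (2 : ZMod p) ≠ 0) (h3 : (3 : ZMod p) ≠ 0)
    {s : ℤ} (hs : s ∈ puncturedInterval 2 4) : (s : ZMod p) ≠ 0 := by
  have h4 : (4 : ZMod p) ≠ 0 := by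
    rw [show (4 : ZMod p) = 2 * 2 by norm_num]; exact mul_ne_zero h2 h2
  rw [puncturedInterval_two_four] at hs
  simp only [Finset.mem_insert, Finset.mem_singleton] at hs
  rcases hs with rfl | rfl | rfl | rfl | rfl | rfl <;> simp [h2, h3, h4]

theorem pow_intCast_of_odd {N : ℕ} (hN2 : Odd N) :
    ((-2 : ℤ) : ZMod p) ^ N = -2 ^ N ∧ ((-1 : ℤ) : ZMod p) ^ N = -1 ∧
      ((1 : ℤ) : ZMod p) ^ N = 1 ∧ ((2 : ℤ) : ZMod p) ^ N = 2 ^ N ∧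
      ((3 : ℤ) : ZMod p) ^ N = 3 ^ N ∧ ((4 : ℤ) : ZMod p) ^ N = (2 ^ N) ^ 2 := by
  refine ⟨?_, ?_, ?_, ?_, ?_, ?_⟩ <;> push_cast
  · exact hN2.neg_pow 2
  · exact hN2.neg_one_pow
  · exact one_pow N
  · rfl
  · rfl
  · rw [← pow_mul, mul_comm, pow_mul]; norm_num

theorem injOn_intCast_pow {N : ℕ} (hN : p = 6 * N + 1) (hN2 : Odd N)
    (h2 : (2 : ZMod p) ≠ 0) (h3 : (3 : ZMod p) ≠ 0)
    (hc2 : (2 : ZMod p) ^ (2 * N) ≠ 1) (hc6 : (6 : ZMod p) ^ (2 * N) = 1) :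
    Set.InjOn (fun s : ℤ => (s : ZMod p) ^ N) (puncturedInterval 2 4) := by
  have hfermat {x : ZMod p} (hx : x ≠ 0) : x ^ (6 * N) = 1 := by
    have := ZMod.pow_card_sub_one_eq_one hx
    rwa [show p - 1 = 6 * N by omega] at this
  obtain ⟨e1, e2, e3, e4, e5, e6⟩ := pow_intCast_of_odd (p := p) hN2
  have hc : ((2 : ZMod p) ^ N) ^ 6 = 1 := by rw [← pow_mul, mul_comm, hfermat h2]
  have hc' : ((2 : ZMod p) ^ N) ^ 2 ≠ 1 := by rwa [← pow_mul, mul_comm]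
  -- A primitive cube root of unity `w` gives `(2w + 1) ^ 2 = -3`, so `(-3) ^ (3N) = 1` and `d ^ 3 =
  -- -1` for odd `N`. Together with `(c d) ^ 2 = 1` this yields `d = -c ^ 2`.
  have hd : (3 : ZMod p) ^ N = -((2 : ZMod p) ^ N) ^ 2 := by
    obtain ⟨g, hg, -⟩ := ZMod.exists_isPrimitiveRoot_units p
    have hg' : IsPrimitiveRoot ((g : ZMod p) ^ (2 * N)) 3 :=
      (IsPrimitiveRoot.coe_units_iff.2 hg).pow (by have := hp.out.one_lt; omega) (by omega)
    have hw := hg'.geom_sum_eq_zero (by norm_num)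
    simp only [Finset.sum_range_succ, Finset.sum_range_zero] at hw
    set w := (g : ZMod p) ^ (2 * N)
    have hsq : (2 * w + 1) ^ 2 = (-3 : ZMod p) := by linear_combination 4 * hw
    have hs0 : 2 * w + 1 ≠ 0 := by
      intro h0
      rw [h0] at hsq
      exact h3 (by linear_combination hsq)
    have h3N : ((3 : ZMod p) ^ N) ^ 3 = -1 := by
      have := hfermat hs0
      rw [show 6 * N = 2 * (N * 3) by ring, pow_mul, hsq, pow_mul, hN2.neg_pow] at this
      linear_combination -this
    have h6 : ((2 : ZMod p) ^ N * 3 ^ N) ^ 2 = 1 := by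
      rw [← mul_pow, ← pow_mul, mul_comm N]; norm_num [hc6]
    linear_combination ((2 : ZMod p) ^ N) ^ 2 * h3N - 3 ^ N * h6
  intro s hs t ht hst
  rw [puncturedInterval_two_four] at hs ht
  simp only [Finset.coe_insert, Finset.coe_singleton, Set.mem_insert_iff,
    Set.mem_singleton_iff] at hs ht
  dsimp only at hst
  rw [hd] at e5
  generalize (2 : ZMod p) ^ N = c at *
  rcases hs with rfl | rfl | rfl | rfl | rfl | rfl <;>
    rcases ht with rfl | rfl | rfl | rfl | rfl | rfl <;>
    first
    | rfl
    | (exfalso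
       simp only [e1, e2, e3, e4, e5, e6] at hst
       clear e1 e2 e3 e4 e5 e6 hc2 hc6 hd hfermat
       grind)

/-- If powers of exponent `N` separate the elements of `[-2, 4]^*` in `ZMod (6 * N + 1)`, the
solutions of `x ^ N = 1` form a nonsingular perfect splitter set. -/
theorem exists_isNonsingularPerfectSplitterSet_of_injOn {N : ℕ} (hN : p = 6 * N + 1)
    (h2 : (2 : ZMod p) ≠ 0) (h3 : (3 : ZMod p) ≠ 0)
    (hinj : Set.InjOn (fun s : ℤ => (s : ZMod p) ^ N) (puncturedInterval 2 4)) :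
    ∃ B : Finset (ZMod p), IsNonsingularPerfectSplitterSet 2 4 p B := by
  have hN0 : 0 < N := by
    have := hp.out.one_lt
    omega
  obtain ⟨g, hg, -⟩ := ZMod.exists_isPrimitiveRoot_units p
  have hg' : IsPrimitiveRoot ((g : ZMod p) ^ 6) N :=
    (IsPrimitiveRoot.coe_units_iff.2 hg).pow (by omega) (by omega)
  let B : Finset (ZMod p) := Polynomial.nthRootsFinset N (1 : ZMod p)
  have hB {b : ZMod p} (hb : b ∈ B) : b ^ N = 1 := (Polynomial.mem_nthRootsFinset hN0 1).1 hb
  have hB0 {b : ZMod p} (hb : b ∈ B) : b ≠ 0 := by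
    rintro rfl
    have := hB hb
    rw [zero_pow hN0.ne'] at this
    exact zero_ne_one this
  refine ⟨B, ⟨⟨⟨hp.out.two_le, by norm_num, ?_, ?_, ?_⟩, ?_⟩, ?_⟩⟩
  · intro b hb
    unfold dilate
    rw [Finset.card_image_of_injOn, puncturedInterval_two_four]
    · rfl
    · intro s hs t ht hst
      have := mul_left_cancel₀ (hB0 hb) hst
      exact hinj hs ht (by simp only [this])
  · intro b hb h0
    obtain ⟨s, hs, hs0⟩ := Finset.mem_image.1 h0
    exact mul_ne_zero (hB0 hb) (intCast_ne_zero_of_mem_puncturedInterval h2 h3 hs) hs0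
  · intro b hb c hc hbc
    rw [Finset.disjoint_left]
    intro x hxb hxc
    obtain ⟨s, hs, rfl⟩ := Finset.mem_image.1 hxb
    obtain ⟨t, ht, hst⟩ := Finset.mem_image.1 hxc
    have h1 := congrArg (· ^ N) hst
    simp only [mul_pow, hB hb, hB hc, one_mul] at h1
    obtain rfl := hinj ht hs h1
    exact hbc (mul_right_cancel₀ (intCast_ne_zero_of_mem_puncturedInterval h2 h3 hs) hst).symm
  · rw [hg'.card_nthRootsFinset, hN]
    push_cast
    ring
  · rw [← Nat.coprime_iff_gcd_eq_one, hp.out.coprime_iff_not_dvd, hp.out.dvd_factorial]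
    omega

/-- A perfect splitter set turns the `N`-th powers of `[-2, 4]^*` into all `N`-th powers. -/
theorem exists_mem_puncturedInterval_pow_eq {N : ℕ} (hN : p = 6 * N + 1)
    (hN2 : ¬ 2 ∣ N) (hN3 : ¬ 3 ∣ N) (h2 : (2 : ZMod p) ≠ 0) (h3 : (3 : ZMod p) ≠ 0)
    {B : Finset (ZMod p)} (hB : IsPerfectSplitterSet 2 4 p B) {y : ZMod p} (hy : y ≠ 0) :
    ∃ s ∈ puncturedInterval 2 4, y ^ N = (s : ZMod p) ^ N := by
  have hcard : B.card = N := by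
    have h := hB.card_eq
    have hN' : (p : ℚ) = 6 * N + 1 := by exact_mod_cast hN
    have : (B.card : ℚ) = N := by rw [h, hN']; push_cast; ring
    exact_mod_cast this
  have h1mem : (1 : ℤ) ∈ puncturedInterval 2 4 := by rw [puncturedInterval_two_four]; simp
  have hB0 {b : ZMod p} (hb : b ∈ B) : b ≠ 0 := by
    rintro rfl
    exact hB.zero_notMem 0 hb (Finset.mem_image.2 ⟨1, h1mem, by simp⟩)
  have hA0 {s : ℤ} (hs : s ∈ puncturedInterval 2 4) :=
    intCast_ne_zero_of_mem_puncturedInterval h2 h3 hs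
  have hAcard : (puncturedInterval 2 4).card = 6 := by rw [puncturedInterval_two_four]; rfl
  let a : puncturedInterval 2 4 → (ZMod p)ˣ := fun s => Units.mk0 _ (hA0 s.2)
  let b : B → (ZMod p)ˣ := fun k => Units.mk0 _ (hB0 k.2)
  have hbij : Function.Bijective fun x : puncturedInterval 2 4 × B => a x.1 * b x.2 := by
    refine (Fintype.bijective_iff_injective_and_card _).2 ⟨?_, ?_⟩
    · rintro ⟨⟨s, hs⟩, ⟨k, hk⟩⟩ ⟨⟨t, ht⟩, ⟨l, hl⟩⟩ h
      have h' : (k : ZMod p) * s = l * t := by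
        have := congrArg Units.val h
        simpa [a, b, mul_comm] using this
      have hkl : k = l := by
        by_contra hne
        exact Finset.disjoint_left.1 (hB.disjoint k hk l hl hne)
          (Finset.mem_image.2 ⟨s, hs, rfl⟩) (Finset.mem_image.2 ⟨t, ht, h'.symm⟩)
      subst hkl
      have hinj := Finset.card_image_iff.1 ((hB.card_dilate k hk).trans hAcard.symm)
      obtain rfl := hinj hs ht h'
      rfl
    · rw [Fintype.card_prod, Fintype.card_coe, Fintype.card_coe, hAcard, hcard,
        ZMod.card_units, hN]
      rfl
  have hκ : Fintype.card B = N := by rw [Fintype.card_coe, hcard]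
  -- Squaring and then cubing the second factor gives the exponent 6, so its `N`-th power is 1 by
  -- Fermat.
  have hbij2 := bijective_mul_pow_of_bijective_mul a b hbij 2 (by rwa [hκ])
  have hbij3 := bijective_mul_pow_of_bijective_mul a (fun k => b k ^ 2) hbij2 3 (by rwa [hκ])
  obtain ⟨⟨⟨s, hs⟩, k⟩, hsk⟩ := hbij3.2 (Units.mk0 y hy)
  refine ⟨s, hs, ?_⟩
  have h := congrArg (fun u : (ZMod p)ˣ => (u : ZMod p) ^ N) hsk
  simp only [a, b, Units.val_mul, Units.val_mk0, Units.val_pow_eq_pow_val] at h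
  have hk := ZMod.pow_card_sub_one_eq_one (hB0 k.2)
  rw [show p - 1 = 6 * N by omega] at hk
  rw [← h, mul_pow, ← pow_mul, ← pow_mul, show 2 * (3 * N) = 6 * N by ring, hk,
    mul_one]

theorem cubic_residues_of_forall_exists_pow_eq {N : ℕ} (hN : p = 6 * N + 1) (hN2 : Odd N)
    (h2 : (2 : ZMod p) ≠ 0)
    (h : ∀ y : ZMod p, y ≠ 0 → ∃ s ∈ puncturedInterval 2 4, y ^ N = (s : ZMod p) ^ N) :
    (2 : ZMod p) ^ (2 * N) ≠ 1 ∧ (6 : ZMod p) ^ (2 * N) = 1 := by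
  obtain ⟨e1, e2, e3, e4, e5, e6⟩ := pow_intCast_of_odd (p := p) hN2
  rw [puncturedInterval_two_four] at h
  simp only [Finset.mem_insert, Finset.mem_singleton, exists_eq_or_imp, exists_eq_left,
    e1, e2, e3, e4, e5, e6] at h
  have hc : ((2 : ZMod p) ^ N) ^ 6 = 1 := by
    have := ZMod.pow_card_sub_one_eq_one h2
    rwa [show p - 1 = N * 6 by omega, pow_mul] at this
  have h4 : (-4 : ZMod p) ^ N = -((2 : ZMod p) ^ N) ^ 2 := by
    rw [hN2.neg_pow, ← pow_mul, mul_comm, pow_mul]; norm_num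
  have h4' := h (-4) (by
    rw [show (-4 : ZMod p) = -(2 * 2) by norm_num]; exact neg_ne_zero.2 (mul_ne_zero h2 h2))
  rw [h4] at h4'
  obtain ⟨g, hg, -⟩ := ZMod.exists_isPrimitiveRoot_units p
  have hg' : IsPrimitiveRoot ((g : ZMod p) ^ (2 * N)) 3 :=
    (IsPrimitiveRoot.coe_units_iff.2 hg).pow (by have := hp.out.one_lt; omega) (by omega)
  have hw := h ((g : ZMod p) ^ 2) (pow_ne_zero _ g.ne_zero)
  have hww := h (((g : ZMod p) ^ 2) ^ 2) (pow_ne_zero _ (pow_ne_zero _ g.ne_zero))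
  rw [← pow_mul _ 2 N] at hw
  rw [pow_right_comm, ← pow_mul _ 2 N] at hww
  have hw1 := hg'.ne_one (by norm_num)
  have hw3 := hg'.pow_eq_one
  have e26 : (6 : ZMod p) ^ (2 * N) = ((2 : ZMod p) ^ N) ^ 2 * (3 ^ N) ^ 2 := by
    rw [← mul_pow, ← mul_pow, ← pow_mul, mul_comm N]; norm_num
  rw [e26, mul_comm 2 N, pow_mul 2 N 2]
  generalize (g : ZMod p) ^ (2 * N) = w at *
  generalize (2 : ZMod p) ^ N = c at *
  generalize (3 : ZMod p) ^ N = d at *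
  clear hg' hg e26 h4 e1 e2 e3 e4 e5 e6 h
  -- If `c = ±1`, the six values reduce to `±1` and `d`, which cannot include both primitive cube
  -- roots of unity `w` and `w ^ 2`.
  have hc2 : c ^ 2 ≠ 1 := by
    intro hc2
    have hwd : w = d := by
      rcases hw with h | h | h | h | h | h <;> first | exact h | (exfalso; grind)
    have hwwd : w ^ 2 = d := by
      rcases hww with h | h | h | h | h | h <;> first | exact h | (exfalso; grind)
    grind
  refine ⟨hc2, ?_⟩
  -- The `N`-th power of `-4` is `-c ^ 2`; given `c ^ 6 = 1` and `c ^ 2 ≠ 1`, only `d` can equal it.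
  have hd : -c ^ 2 = d := by
    rcases h4' with h | h | h | h | h | h <;> first | exact h | (exfalso; grind)
  rw [← hd]
  linear_combination hc

end

/-! ### From splitter sets to Eisenstein norms -/

theorem natCast_eq_primaryElement_mul_conj_iff (p : ℕ) (m n : ℤ) :
    (p : ℂ) = primaryElement m n * starRingEnd ℂ (primaryElement m n) ↔
      (p : ℤ) = (3 * m - 1) ^ 2 - (3 * m - 1) * (3 * n) + (3 * n) ^ 2 := by
  have h3 : (Real.sqrt 3 : ℂ) ^ 2 = 3 := by
    rw [← Complex.ofReal_pow, Real.sq_sqrt (by norm_num)]; norm_num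
  have h : primaryElement m n * starRingEnd ℂ (primaryElement m n) =
      (((3 * m - 1) ^ 2 - (3 * m - 1) * (3 * n) + (3 * n) ^ 2 : ℤ) : ℂ) := by
    simp only [primaryElement, eisensteinOmega, map_add, map_sub, map_mul, map_div₀, map_neg,
      map_one, map_ofNat, map_intCast, Complex.conj_ofReal, Complex.conj_I]
    push_cast
    linear_combination (-(9 / 4 : ℂ) * n ^ 2 * (Real.sqrt 3 : ℂ) ^ 2) * Complex.I_sq +
      (9 / 4 : ℂ) * n ^ 2 * h3
  rw [h, ← Int.cast_natCast (R := ℂ), Int.cast_inj]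

/-- Nonsingular perfect `B[-2, 4](p)` sets exist exactly when `6` is a cubic residue modulo `p`
and `2` is not. -/
theorem exists_isNonsingularPerfectSplitterSet_iff_cubic {p N : ℕ} [hp : Fact p.Prime]
    (hN : p = 6 * N + 1) (hN2 : ¬ 2 ∣ N) (hN3 : ¬ 3 ∣ N) (h2 : (2 : ZMod p) ≠ 0)
    (h3 : (3 : ZMod p) ≠ 0) :
    (∃ B : Finset (ZMod p), IsNonsingularPerfectSplitterSet 2 4 p B) ↔
      (2 : ZMod p) ^ (2 * N) ≠ 1 ∧ (6 : ZMod p) ^ (2 * N) = 1 := by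
  have hodd : Odd N := Nat.odd_iff.2 (by omega)
  constructor
  · rintro ⟨B, hB⟩
    exact cubic_residues_of_forall_exists_pow_eq hN hodd h2 fun y hy =>
      exists_mem_puncturedInterval_pow_eq hN hN2 hN3 h2 h3 hB.toIsPerfectSplitterSet hy
  · rintro ⟨hc2, hc6⟩
    exact exists_isNonsingularPerfectSplitterSet_of_injOn hN h2 h3
      (injOn_intCast_pow hN hodd h2 h3 hc2 hc6)

theorem cubic_residues_iff_exists_decomposition {p N : ℕ} [hp : Fact p.Prime]
    (hN : p = 6 * N + 1) (h2 : (2 : ZMod p) ≠ 0) (h3 : (3 : ZMod p) ≠ 0) :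
    ((2 : ZMod p) ^ (2 * N) ≠ 1 ∧ (6 : ZMod p) ^ (2 * N) = 1) ↔
      ∃ m n : ℤ, (p : ℤ) = (3 * m - 1) ^ 2 - (3 * m - 1) * (3 * n) + (3 * n) ^ 2 ∧
        Odd m ∧ Odd n ∧ n ≡ 1 [ZMOD 3] := by
  have hp3 : 3 ∣ p - 1 := ⟨2 * N, by omega⟩
  obtain ⟨χ, hχ⟩ := MulChar.exists_mulChar_orderOf (ZMod p) (by rwa [ZMod.card])
    (Complex.isPrimitiveRoot_exp 3 (by norm_num))
  have hχ3 : χ ^ 3 = 1 := by rw [← hχ, pow_orderOf_eq_one]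
  have hχ1 : χ ≠ 1 := by
    rintro rfl
    rw [orderOf_one] at hχ
    norm_num at hχ
  have h6 : (6 : ZMod p) ≠ 0 := by
    rw [show (6 : ZMod p) = 2 * 3 by norm_num]; exact mul_ne_zero h2 h3
  rw [Ne, ← MulChar.cubic_apply_eq_one_iff hN hχ1 hχ3 h2,
    ← MulChar.cubic_apply_eq_one_iff hN hχ1 hχ3 h6]
  constructor
  · rintro ⟨hχ2, hχ6⟩
    obtain ⟨m, n, hmn, hm, hn, hiff⟩ :=
      exists_decomposition_of_cubic_apply_two_ne_one h2 h3 hp3 hχ1 hχ3 hχ2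
    exact ⟨m, n, hmn, hm, hn, hiff.1 hχ6⟩
  · rintro ⟨m', n', hmn', hm', hn', hn3⟩
    rw [Int.odd_iff] at hm' hn'
    have hχ2 : χ 2 ≠ 1 := by
      intro hχ2
      obtain ⟨m, n, hmn, hn⟩ :=
        exists_decomposition_of_cubic_apply_two_eq_one h2 hp3 hχ1 hχ3 hχ2
      rw [Int.even_iff] at hn
      have := norm_decomposition_unique hp.out hmn hmn'
      omega
    -- The given pair may be the conjugate of the Jacobi pair, but conjugation `(m - n, -n)` makes
    -- the first entry even when both are odd; so the pairs agree.
    refine ⟨hχ2, ?_⟩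
    obtain ⟨m, n, hmn, hm, hn, hiff⟩ :=
      exists_decomposition_of_cubic_apply_two_ne_one h2 h3 hp3 hχ1 hχ3 hχ2
    rw [Int.odd_iff] at hm hn
    rcases norm_decomposition_unique hp.out hmn hmn' with ⟨-, rfl⟩ | ⟨h, -⟩
    · exact hiff.2 hn3
    · omega

/-! ### The three quadratic forms -/

section

variable {P : ℤ}

theorem exists_form_iff_m_modEq_one :
    (∃ k l : ℤ, P = 1296 * k ^ 2 - 648 * k * l + 324 * l ^ 2 + 36 * k + 72 * l + 7) ↔
      ∃ m n : ℤ, P = (3 * m - 1) ^ 2 - (3 * m - 1) * (3 * n) + (3 * n) ^ 2 ∧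
        Odd m ∧ Odd n ∧ n ≡ 1 [ZMOD 3] ∧ m ≡ 1 [ZMOD 12] := by
  simp only [Int.odd_iff, Int.ModEq]
  constructor
  · rintro ⟨k, l, h⟩
    exact ⟨12 * k + 1, 6 * l + 1, by rw [h]; ring, by omega, by omega, by omega, by omega⟩
  · rintro ⟨m, n, h, -, hn, hn3, hm⟩
    obtain ⟨k, rfl⟩ : ∃ k, m = 12 * k + 1 := ⟨m / 12, by omega⟩
    obtain ⟨l, rfl⟩ : ∃ l, n = 6 * l + 1 := ⟨n / 6, by omega⟩
    exact ⟨k, l, by rw [h]; ring⟩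

theorem exists_form_iff_m_modEq_nine :
    (∃ k l : ℤ, P = 1296 * k ^ 2 - 648 * k * l + 324 * l ^ 2 + 1764 * k - 360 * l + 607) ↔
      ∃ m n : ℤ, P = (3 * m - 1) ^ 2 - (3 * m - 1) * (3 * n) + (3 * n) ^ 2 ∧
        Odd m ∧ Odd n ∧ n ≡ 1 [ZMOD 3] ∧ m ≡ 9 [ZMOD 12] := by
  simp only [Int.odd_iff, Int.ModEq]
  constructor
  · rintro ⟨k, l, h⟩
    exact ⟨12 * k + 9, 6 * l + 1, by rw [h]; ring, by omega, by omega, by omega, by omega⟩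
  · rintro ⟨m, n, h, -, hn, hn3, hm⟩
    obtain ⟨k, rfl⟩ : ∃ k, m = 12 * k + 9 := ⟨m / 12, by omega⟩
    obtain ⟨l, rfl⟩ : ∃ l, n = 6 * l + 1 := ⟨n / 6, by omega⟩
    exact ⟨k, l, by rw [h]; ring⟩

variable (hP : P % 36 = 7 ∨ P % 36 = 31)
include hP

/-- Substitute `m = 2k`, `n = 6l + 5`. The form is `6 (k + 3l) + 25` mod 36, so the side condition
on `k + 3l` follows from `hP`. -/
theorem exists_form_iff_m_even :
    (∃ k l : ℤ, P = 36 * k ^ 2 - 108 * k * l + 324 * l ^ 2 - 102 * k + 558 * l + 241 ∧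
        (k + 3 * l ≡ 1 [ZMOD 6] ∨ k + 3 * l ≡ 3 [ZMOD 6])) ↔
      ∃ m n : ℤ, P = (3 * m - 1) ^ 2 - (3 * m - 1) * (3 * n) + (3 * n) ^ 2 ∧
        Even m ∧ Odd n ∧ n ≡ 2 [ZMOD 3] := by
  simp only [Int.odd_iff, Int.even_iff, Int.ModEq]
  constructor
  · rintro ⟨k, l, h, -⟩
    exact ⟨2 * k, 6 * l + 5, by rw [h]; ring, by omega, by omega, by omega⟩
  · rintro ⟨m, n, h, hm, hn, hn3⟩
    obtain ⟨k, rfl⟩ : ∃ k, m = 2 * k := ⟨m / 2, by omega⟩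
    obtain ⟨l, rfl⟩ : ∃ l, n = 6 * l + 5 := ⟨n / 6, by omega⟩
    have h' : P = 36 * (k ^ 2 - 3 * (k * l) + 9 * l ^ 2) - 102 * k + 558 * l + 241 := by
      rw [h]; ring
    exact ⟨k, l, by rw [h]; ring, by omega⟩

/-- With `m = 2a + 1` the norm is `6a + 7` mod 36, so `a` is 0 or 4 mod 6. -/
theorem m_modEq_one_or_nine {m n : ℤ}
    (h : P = (3 * m - 1) ^ 2 - (3 * m - 1) * (3 * n) + (3 * n) ^ 2)
    (hm : Odd m) (hn : Odd n) (hn3 : n ≡ 1 [ZMOD 3]) : m ≡ 1 [ZMOD 12] ∨ m ≡ 9 [ZMOD 12] := by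
  simp only [Int.odd_iff, Int.ModEq] at *
  obtain ⟨a, rfl⟩ : ∃ a, m = 2 * a + 1 := ⟨m / 2, by omega⟩
  obtain ⟨b, rfl⟩ : ∃ b, n = 6 * b + 1 := ⟨n / 6, by omega⟩
  have h' : P = 36 * (a ^ 2 - 3 * (a * b) + 9 * b ^ 2) + 6 * a + 72 * b + 7 := by
    rw [h]; ring
  omega

end

theorem mainTheorem5 (p : ℕ) (hp : p.Prime) (hp6 : p ≡ 1 [MOD 6])
    (hgcd : Nat.gcd ((p - 1) / 6) 6 = 1) :
    ((∃ B : Finset (ZMod p), IsNonsingularPerfectSplitterSet 2 4 p B) ↔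
      ∃ k l : ℤ,
        (p : ℤ) = 1296 * k ^ 2 - 648 * k * l + 324 * l ^ 2 + 36 * k + 72 * l + 7 ∨
        (p : ℤ) = 1296 * k ^ 2 - 648 * k * l + 324 * l ^ 2 + 1764 * k - 360 * l + 607 ∨
        ((p : ℤ) = 36 * k ^ 2 - 108 * k * l + 324 * l ^ 2 - 102 * k + 558 * l + 241 ∧
          (k + 3 * l ≡ 1 [ZMOD 6] ∨ k + 3 * l ≡ 3 [ZMOD 6]))) ∧
    -- the decompositions `p = π π̄`, `π = 3m - 1 + 3nω`, to which the three cases correspond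
    ((∃ k l : ℤ,
        (p : ℤ) = 1296 * k ^ 2 - 648 * k * l + 324 * l ^ 2 + 36 * k + 72 * l + 7) ↔
      ∃ m n : ℤ, (p : ℂ) = primaryElement m n * starRingEnd ℂ (primaryElement m n) ∧
        Odd m ∧ Odd n ∧ n ≡ 1 [ZMOD 3] ∧ m ≡ 1 [ZMOD 12]) ∧
    ((∃ k l : ℤ,
        (p : ℤ) = 1296 * k ^ 2 - 648 * k * l + 324 * l ^ 2 + 1764 * k - 360 * l + 607) ↔
      ∃ m n : ℤ, (p : ℂ) = primaryElement m n * starRingEnd ℂ (primaryElement m n) ∧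
        Odd m ∧ Odd n ∧ n ≡ 1 [ZMOD 3] ∧ m ≡ 9 [ZMOD 12]) ∧
    ((∃ k l : ℤ,
        (p : ℤ) = 36 * k ^ 2 - 108 * k * l + 324 * l ^ 2 - 102 * k + 558 * l + 241 ∧
          (k + 3 * l ≡ 1 [ZMOD 6] ∨ k + 3 * l ≡ 3 [ZMOD 6])) ↔
      ∃ m n : ℤ, (p : ℂ) = primaryElement m n * starRingEnd ℂ (primaryElement m n) ∧
        Even m ∧ Odd n ∧ n ≡ 2 [ZMOD 3]) := by
  obtain ⟨N, hN⟩ : ∃ N, p = 6 * N + 1 := ⟨p / 6, by have : p % 6 = 1 := hp6; omega⟩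
  rw [show (p - 1) / 6 = N by omega] at hgcd
  have hN2 : ¬ 2 ∣ N := fun h => by
    have := Nat.dvd_gcd h (show 2 ∣ 6 by norm_num)
    omega
  have hN3 : ¬ 3 ∣ N := fun h => by
    have := Nat.dvd_gcd h (show 3 ∣ 6 by norm_num)
    omega
  -- Being prime to 6, `N` is 1 or 5 mod 6.
  have hP : (p : ℤ) % 36 = 7 ∨ (p : ℤ) % 36 = 31 := by omega
  have : Fact p.Prime := ⟨hp⟩
  have h2 : (2 : ZMod p) ≠ 0 := by
    exact_mod_cast natCast_ne_zero_of_lt (p := p) two_ne_zero (by omega)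
  have h3 : (3 : ZMod p) ≠ 0 := by
    exact_mod_cast natCast_ne_zero_of_lt (p := p) three_ne_zero (by omega)
  simp only [natCast_eq_primaryElement_mul_conj_iff]
  refine ⟨?_, exists_form_iff_m_modEq_one, exists_form_iff_m_modEq_nine,
    exists_form_iff_m_even hP⟩
  rw [exists_isNonsingularPerfectSplitterSet_iff_cubic hN hN2 hN3 h2 h3,
    cubic_residues_iff_exists_decomposition hN h2 h3]
  simp only [exists_or]
  rw [exists_form_iff_m_modEq_one, exists_form_iff_m_modEq_nine, exists_form_iff_m_even hP]
  constructor
  · rintro ⟨m, n, h, hm, hn, hn3⟩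
    rcases m_modEq_one_or_nine hP h hm hn hn3 with hm' | hm'
    · exact Or.inl ⟨m, n, h, hm, hn, hn3, hm'⟩
    · exact Or.inr (Or.inl ⟨m, n, h, hm, hn, hn3, hm'⟩)
  · rintro (⟨m, n, h, hm, hn, hn3, -⟩ | ⟨m, n, h, hm, hn, hn3, -⟩ | ⟨m, n, h, hm, hn, hn3⟩)
    · exact ⟨m, n, h, hm, hn, hn3⟩
    · exact ⟨m, n, h, hm, hn, hn3⟩
    -- Complex conjugation of `3m - 1 + 3nω` carries the third case into the normalization `m` odd,
    -- `n` congruent to 1 mod 3.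
    · refine ⟨m - n, -n, by rw [h]; ring, hm.sub_odd hn, hn.neg, ?_⟩
      simp only [Int.ModEq] at *
      omega
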